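/- Let $X$ be a compact metric space with a finite Borel measure $dx$, and write $|X|$ for the total mass. Let $H_0$ be a non-negative self-adjoint operator on $L^2(X,dx)$ with discrete spectrum (every point of the spectrum is isolated in it and is an eigenvalue of finite multiplicity), and suppose that for some constant $d>0$: - (H1) for $t>0$ the operator $e^{-H_0t}$ has a non-negative integral kernel $K_0(t,x,y)$ that is continuous on $(0,\infty)\times X\times X$; - (H2) there is a constant $c>0$ such that $0\le K_0(t,x,x)\le c\,t^{-d/2}$ for all $t\in(0,1)$ and all $x\in X$; - (H3) there is a constant $a>0$ such that $\lim_{t\to0+}t^{d/2}K_0(t,x,x)=a$ for all $x$ outside a set of measure zero; - (H4) the smallest eigenvalue of $H_0$ is $0$, it has multiplicity $1$, and the constant function $|X|^{-1/2}$ is a corresponding eigenfunction. Let $V\in L^\infty(X,dx)$ be a real-valued potential, and let $H=H_0+V$ with the domain of $H_0$. Then $H$ has a smallest eigenvalue $\mu_1$; and if $\mu_1\ge 0$ and $$\int_X V(x)\,dx\le 0,$$ then $V=0$ (almost everywhere). -/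

import Mathlib

open MeasureTheory Filter Topology Set
open scoped ENNReal InnerProductSpace

noncomputable section

/-! ### Unbounded operators on a Hilbert space -/

section Operators

variable {𝕜 E : Type*} [RCLike 𝕜] [NormedAddCommGroup E] [InnerProductSpace 𝕜 E]

/-- The operator `A - z` with domain `Dom A`, as a linear map from `Dom A` to the whole space. -/
def subScalar (A : E →ₗ.[𝕜] E) (z : 𝕜) : A.domain →ₗ[𝕜] E :=
  A.toFun - z • A.domain.subtype

/-- The eigenspace `{f ∈ Dom A | A f = z f}` of an unbounded operator. -/
def eigenspaceOf (A : E →ₗ.[𝕜] E) (z : 𝕜) : Submodule 𝕜 E :=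
  (LinearMap.ker (subScalar A z)).map A.domain.subtype

/-- The set of real eigenvalues of an unbounded operator (all of its eigenvalues, if the operator
is symmetric). -/
def realEigenvalues (A : E →ₗ.[𝕜] E) : Set ℝ :=
  {l | eigenspaceOf A (l : 𝕜) ≠ ⊥}

/-- The spectrum of an unbounded operator: the scalars `z` such that `A - z` is not a bijection
from `Dom A` onto the whole space. For a closed operator, such as a self-adjoint one, the inverse
of such a bijection is automatically bounded. -/
def spectrumOf (A : E →ₗ.[𝕜] E) : Set 𝕜 :=
  {z | ¬ Function.Bijective (subScalar A z)}

/-- The spectrum is discrete: each of its points is isolated in it and is an eigenvalue of finite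
multiplicity. -/
def HasDiscreteSpectrum (A : E →ₗ.[𝕜] E) : Prop :=
  ∀ z ∈ spectrumOf A, ¬ AccPt z (𝓟 (spectrumOf A)) ∧
    eigenspaceOf A z ≠ ⊥ ∧ FiniteDimensional 𝕜 (eigenspaceOf A z)

/-- `A` is a non-negative operator: `0 ≤ ⟨A f, f⟩` for all `f ∈ Dom A`. -/
def IsNonnegOperator (A : E →ₗ.[𝕜] E) : Prop :=
  ∀ f : A.domain, 0 ≤ RCLike.re ⟪A f, (f : E)⟫_𝕜

/-- `T t = exp (-t A)` for `t ≥ 0`: the family `T` is the (unique) strongly continuous one-parameter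
semigroup of bounded operators whose infinitesimal generator is `-A`. The values of `T` at negative
times are irrelevant. -/
structure IsSemigroupExpNeg (A : E →ₗ.[𝕜] E) (T : ℝ → E →L[𝕜] E) : Prop where
  zero : T 0 = ContinuousLinearMap.id 𝕜 E
  add : ∀ s t : ℝ, 0 ≤ s → 0 ≤ t → T (s + t) = (T s).comp (T t)
  strongly_continuous : ∀ f : E, ContinuousOn (fun t : ℝ => T t f) (Ici 0)
  generator : ∀ f g : E, (f, g) ∈ (-A).graph ↔
    Tendsto (fun t : ℝ => ((t⁻¹ : ℝ) : 𝕜) • (T t f - f)) (𝓝[>] 0) (𝓝 g)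

end Operators

/-! ### Operators on `L²` -/

section L2

variable {X 𝕜 : Type*} [MeasurableSpace X] [RCLike 𝕜]

/-- Multiplication by an essentially bounded real function `V`, on `L²`. -/
def mulPotential (𝕜 : Type*) [RCLike 𝕜] (μ : Measure X) (V : Lp ℝ ∞ μ) :
    Lp 𝕜 2 μ →ₗ[𝕜] Lp 𝕜 2 μ where
  toFun f := V • f
  map_add' f g := Lp.add_smul V f g
  map_smul' c f := by
    apply Lp.ext
    filter_upwards [Lp.coeFn_lpSMul (r := 2) V (c • f), Lp.coeFn_smul c f,
      Lp.coeFn_smul c (V • f : Lp 𝕜 2 μ), Lp.coeFn_lpSMul (r := 2) V f] with x h1 h2 h3 h4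
    simp only [RingHom.id_apply]
    rw [h1, h3, Pi.smul_apply', Pi.smul_apply, h2, h4, Pi.smul_apply', Pi.smul_apply, smul_comm]

/-- The operator `H₀ + V`, with the domain of `H₀`. -/
def addPotential {μ : Measure X} (H₀ : Lp 𝕜 2 μ →ₗ.[𝕜] Lp 𝕜 2 μ) (V : Lp ℝ ∞ μ) :
    Lp 𝕜 2 μ →ₗ.[𝕜] Lp 𝕜 2 μ where
  domain := H₀.domain
  toFun := H₀.toFun + (mulPotential 𝕜 μ V).comp H₀.domain.subtype

/-- The operators `T t`, `t > 0`, have the integral kernel `K t x y`, which is non-negative and is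
continuous on `(0, ∞) × X × X`. -/
structure IsContinuousKernel [TopologicalSpace X] (μ : Measure X)
    (T : ℝ → Lp 𝕜 2 μ →L[𝕜] Lp 𝕜 2 μ) (K : ℝ → X → X → ℝ) : Prop where
  nonneg : ∀ t : ℝ, 0 < t → ∀ x y : X, 0 ≤ K t x y
  continuousOn : ContinuousOn (fun p : ℝ × X × X => K p.1 p.2.1 p.2.2) (Ioi 0 ×ˢ univ)
  integral_eq : ∀ t : ℝ, 0 < t → ∀ f : Lp 𝕜 2 μ,
    T t f =ᵐ[μ] fun x => ∫ y, (K t x y : 𝕜) * f y ∂μ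

/-- On-diagonal upper bound `0 ≤ K t x x ≤ c t ^ (-d / 2)` for `0 < t < 1`. -/
def HasDiagonalBound (K : ℝ → X → X → ℝ) (d : ℝ) : Prop :=
  ∃ c : ℝ, 0 < c ∧ ∀ t ∈ Ioo (0 : ℝ) 1, ∀ x : X,
    0 ≤ K t x x ∧ K t x x ≤ c * t ^ (-d / 2)

/-- On-diagonal small time asymptotics: `t ^ (d / 2) * K t x x → a` as `t → 0+`, outside a null set,
for a constant `a > 0`. -/
def HasDiagonalLimit (μ : Measure X) (K : ℝ → X → X → ℝ) (d : ℝ) : Prop :=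
  ∃ a : ℝ, 0 < a ∧ ∀ᵐ x ∂μ,
    Tendsto (fun t : ℝ => t ^ (d / 2) * K t x x) (𝓝[>] 0) (𝓝 a)

/-- The smallest eigenvalue of `H₀` is `0`, it has multiplicity `1`, and the constant function
`|X| ^ (-1 / 2)` is a corresponding eigenfunction. -/
structure HasConstantGroundState {μ : Measure X} [IsFiniteMeasure μ]
    (H₀ : Lp 𝕜 2 μ →ₗ.[𝕜] Lp 𝕜 2 μ) : Prop where
  isLeast : IsLeast (realEigenvalues H₀) 0
  multiplicity : Module.finrank 𝕜 (eigenspaceOf H₀ 0) = 1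
  eigenfunction : Lp.const 2 μ ((μ.real univ ^ (-(1 / 2) : ℝ) : ℝ) : 𝕜) ∈ eigenspaceOf H₀ 0

end L2

end

/-!
The theorem rests on the variational principle: `H = H₀ + V` has a lowest eigenvalue `m`, and
`m ‖f‖² ≤ ⟪H f, f⟫` for all `f` in the domain. Granted this, suppose `m ≥ 0` and `∫ V ≤ 0`. The
form of `H` is then non-negative, whereas on a constant `u = a` with `H₀ u = 0` it equals
`a² ∫ V ≤ 0`. So `u` minimises the form, and the Cauchy–Schwarz inequality for the form
(`norm_inner_sq_le_of_nonneg`) makes `H u = V u` orthogonal to the dense domain; hence `V = 0`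
(`eq_zero_of_form_nonneg`).

The variational principle (`IsSelfAdjoint.exists_lowest_eigenvalue_of_coercive`) is obtained from a
compact inverse. A large multiple of the identity is added to make `H` coercive; it is then a
bijection from its domain onto `L²`, with a bounded non-negative inverse `R`
(`IsSelfAdjoint.surjective_add_of_norm_le`). The heat operators `exp (-t H₀)` are compact because
their kernels are continuous (`isCompactOperator_of_continuous_kernel`), and
`‖exp (-t H₀) f - f‖ ≤ M t ‖H₀ f‖` (`IsSemigroupExpNeg.exists_norm_sub_le`), so that
`exp (-t H₀) R` tends to `R` in norm as `t → 0+`, and `R` is compact. A non-negative compact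
operator has its norm as an eigenvalue
(`exists_apply_eq_norm_smul_of_isCompactOperator`), and `1 / ‖R‖` is the lowest eigenvalue of the
shifted operator.
-/

/-! ### Self-adjoint operators and their bounded perturbations -/

section Form

variable {𝕜 E : Type*} [RCLike 𝕜] [NormedAddCommGroup E] [InnerProductSpace 𝕜 E]

/-- The Cauchy–Schwarz inequality for the form `⟪L x, y⟫` of a non-negative symmetric operator
that is only defined on a subspace. -/
theorem norm_inner_sq_le_of_nonneg {D : Submodule 𝕜 E} (L : D →ₗ[𝕜] E)
    (hsymm : ∀ x y : D, ⟪L x, (y : E)⟫_𝕜 = ⟪(x : E), L y⟫_𝕜)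
    (hnonneg : ∀ x : D, 0 ≤ RCLike.re ⟪L x, (x : E)⟫_𝕜) (x y : D) :
    ‖⟪L x, (y : E)⟫_𝕜‖ ^ 2 ≤ RCLike.re ⟪L x, (x : E)⟫_𝕜 * RCLike.re ⟪L y, (y : E)⟫_𝕜 := by
  let core : PreInnerProductSpace.Core 𝕜 D :=
    { inner := fun x y => ⟪L x, (y : E)⟫_𝕜
      conj_inner_symm := fun x y => by rw [inner_conj_symm]; exact (hsymm x y).symm
      re_inner_nonneg := hnonneg
      add_left := fun x y z => by simp [inner_add_left]
      smul_left := fun x y r => by simp [inner_smul_left] }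
  have h := @InnerProductSpace.Core.inner_mul_inner_self_le 𝕜 D _ _ _ core x y
  have e : ‖⟪L y, (x : E)⟫_𝕜‖ = ‖⟪L x, (y : E)⟫_𝕜‖ := by
    rw [hsymm x y, ← inner_conj_symm, RCLike.norm_conj]
  calc ‖⟪L x, (y : E)⟫_𝕜‖ ^ 2 = ‖⟪L x, (y : E)⟫_𝕜‖ * ‖⟪L y, (x : E)⟫_𝕜‖ := by rw [e, sq]
    _ ≤ _ := h

end Form

section Hilbert

variable {𝕜 E : Type*} [RCLike 𝕜] [NormedAddCommGroup E] [InnerProductSpace 𝕜 E] [CompleteSpace E]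

theorem IsSelfAdjoint.inner_apply_left {A : E →ₗ.[𝕜] E} (hA : IsSelfAdjoint A) (x y : A.domain) :
    ⟪A x, (y : E)⟫_𝕜 = ⟪(x : E), A y⟫_𝕜 := by
  have h := LinearPMap.adjoint_isFormalAdjoint hA.dense_domain
  rw [LinearPMap.isSelfAdjoint_def.mp hA] at h
  exact h x y

/-- A vector `y` on which `x ↦ ⟪y, A x⟫` is represented by `w` lies in the domain of the
self-adjoint operator `A`, and `A y = w`. -/
theorem IsSelfAdjoint.exists_apply_eq {A : E →ₗ.[𝕜] E} (hA : IsSelfAdjoint A) {y w : E}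
    (h : ∀ x : A.domain, ⟪w, (x : E)⟫_𝕜 = ⟪y, A x⟫_𝕜) :
    ∃ z : A.domain, (z : E) = y ∧ A z = w := by
  have key : ∀ B : E →ₗ.[𝕜] E, B = A.adjoint → ∃ z : B.domain, (z : E) = y ∧ B z = w := by
    rintro B rfl
    exact ⟨⟨y, LinearPMap.mem_adjoint_domain_of_exists y ⟨w, h⟩⟩, rfl,
      LinearPMap.adjoint_apply_eq hA.dense_domain _ h⟩
  exact key A (LinearPMap.isSelfAdjoint_def.mp hA).symm

/-- A bounded symmetric perturbation of a self-adjoint operator is onto as soon as it is bounded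
below in norm: its range is then closed, and a vector orthogonal to the range is annihilated by the
operator. -/
theorem IsSelfAdjoint.surjective_add_of_norm_le {A : E →ₗ.[𝕜] E} (hA : IsSelfAdjoint A)
    {B : E →L[𝕜] E} (hB : (B : E →ₗ[𝕜] E).IsSymmetric)
    (hlow : ∀ f : A.domain, ‖(f : E)‖ ≤ ‖A f + B f‖) (g : E) :
    ∃ f : A.domain, A f + B f = g := by
  let L : A.domain →ₗ[𝕜] E := A.toFun + (B : E →ₗ[𝕜] E).comp A.domain.subtype
  have hL : ∀ f, L f = A f + B f := fun f => rfl
  have hclosed : IsClosed (LinearMap.range L : Set E) := by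
    refine isClosed_of_closure_subset fun g hg => ?_
    obtain ⟨u, hu, hug⟩ := mem_closure_iff_seq_limit.mp hg
    choose f hf using hu
    have hcauchy : CauchySeq fun n => ((f n : A.domain) : E) := by
      refine Metric.cauchySeq_iff.mpr fun ε hε => ?_
      obtain ⟨N, hN⟩ := Metric.cauchySeq_iff.mp hug.cauchySeq ε hε
      refine ⟨N, fun m hm n hn => lt_of_le_of_lt ?_ (hN m hm n hn)⟩
      have := hlow (f m - f n)
      rw [← hL, map_sub, hf, hf] at this
      simpa [dist_eq_norm] using this
    -- The limit lies in the domain because `A`, being self-adjoint, is closed.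
    obtain ⟨y, hy⟩ := cauchySeq_tendsto_of_complete hcauchy
    have hAf : Tendsto (fun n => A (f n)) atTop (𝓝 (g - B y)) := by
      have := hug.sub ((B.continuous.tendsto y).comp hy)
      refine this.congr fun n => ?_
      simp [← hf n, hL]
    obtain ⟨z, hz, hAz⟩ := hA.exists_apply_eq (y := y) (w := g - B y) fun x => by
      have h1 : Tendsto (fun n => ⟪A (f n), (x : E)⟫_𝕜) atTop (𝓝 ⟪g - B y, (x : E)⟫_𝕜) :=
        hAf.inner tendsto_const_nhds
      have h2 : Tendsto (fun n => ⟪((f n : A.domain) : E), A x⟫_𝕜) atTop (𝓝 ⟪y, A x⟫_𝕜) :=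
        hy.inner tendsto_const_nhds
      refine tendsto_nhds_unique h1 (h2.congr fun n => ?_)
      rw [hA.inner_apply_left]
    refine ⟨z, ?_⟩
    rw [hL, hAz, hz, sub_add_cancel]
  have hbot : (LinearMap.range L)ᗮ = ⊥ := by
    refine (Submodule.eq_bot_iff _).mpr fun y hy => ?_
    obtain ⟨z, hz, hAz⟩ := hA.exists_apply_eq (y := y) (w := -B y) fun x => by
      have h := (Submodule.mem_orthogonal' _ _).mp hy (L x) ⟨x, rfl⟩
      rw [hL, inner_add_right] at h
      have h' : ⟪B y, (x : E)⟫_𝕜 = ⟪y, B x⟫_𝕜 := hB y x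
      rw [inner_neg_left, h', eq_comm]
      exact eq_neg_of_add_eq_zero_left h
    have h := hlow z
    rw [hAz, hz, neg_add_cancel, norm_zero] at h
    exact norm_le_zero_iff.mp h
  have htop : LinearMap.range L = ⊤ := by
    have : CompleteSpace (LinearMap.range L) := hclosed.completeSpace_coe
    exact (Submodule.orthogonal_eq_bot_iff).mp hbot
  obtain ⟨f, hf⟩ := LinearMap.range_eq_top.mp htop g
  exact ⟨f, hf⟩

/-! ### Compact semigroups and the lowest eigenvalue -/

/-- The semigroup of `-A` is Lipschitz at time `0` on `Dom A`, with a constant controlled by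
`‖A f‖`: the right derivative of `t ↦ T t f` is `-T t (A f)`, and the semigroup is bounded on
`[0, 1]` by the uniform boundedness principle. -/
theorem IsSemigroupExpNeg.exists_norm_sub_le {A : E →ₗ.[𝕜] E} {T : ℝ → E →L[𝕜] E}
    (hT : IsSemigroupExpNeg A T) :
    ∃ M : ℝ, 0 ≤ M ∧ ∀ t ∈ Icc (0 : ℝ) 1, ∀ f : A.domain,
      ‖T t (f : E) - f‖ ≤ M * ‖A f‖ * t := by
  obtain ⟨M, hM⟩ : ∃ M, ∀ t : Icc (0 : ℝ) 1, ‖T t‖ ≤ M := by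
    refine banach_steinhaus fun f => ?_
    have hc : ContinuousOn (fun t : ℝ => T t f) (Icc 0 1) :=
      (hT.strongly_continuous f).mono Icc_subset_Ici_self
    obtain ⟨C, hC⟩ := isCompact_Icc.exists_bound_of_continuousOn hc
    exact ⟨C, fun t => hC t t.2⟩
  have hM0 : 0 ≤ M := (norm_nonneg _).trans (hM ⟨0, by simp⟩)
  refine ⟨M, hM0, fun t ht f => ?_⟩
  -- The time derivative needs a real structure on `E`; the one induced by `𝕜` is used.
  let : NormedSpace ℝ E := NormedSpace.restrictScalars ℝ 𝕜 E
  have hgen := (hT.generator f (-A f)).mp ((LinearPMap.mem_graph_iff _).mpr ⟨f, rfl, rfl⟩)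
  have hderiv : ∀ s ∈ Ico (0 : ℝ) 1,
      HasDerivWithinAt (fun t => T t (f : E)) (T s (-A f)) (Ici s) s := by
    intro s hs
    rw [← hasDerivWithinAt_Ioi_iff_Ici, hasDerivWithinAt_iff_tendsto_slope' self_notMem_Ioi]
    have hshift : Tendsto (fun u : ℝ => u - s) (𝓝[>] s) (𝓝[>] 0) := by
      refine tendsto_nhdsWithin_iff.mpr ⟨?_, ?_⟩
      · have : Tendsto (fun u : ℝ => u - s) (𝓝 s) (𝓝 (s - s)) := tendsto_id.sub_const s
        rw [sub_self] at this
        exact this.mono_left nhdsWithin_le_nhds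
      · filter_upwards [self_mem_nhdsWithin] with u hu using sub_pos.mpr (mem_Ioi.mp hu)
    refine (((T s).continuous.tendsto _).comp (hgen.comp hshift)).congr' ?_
    filter_upwards [self_mem_nhdsWithin] with u hu
    have hu' : 0 ≤ u - s := sub_nonneg.mpr (mem_Ioi.mp hu).le
    have hadd : T u = (T s).comp (T (u - s)) := by
      rw [← hT.add s (u - s) hs.1 hu', add_sub_cancel]
    simp only [Function.comp_apply, slope_def_module, map_smul, map_sub]
    rw [hadd, ContinuousLinearMap.comp_apply]
    rfl
  have h := norm_image_sub_le_of_norm_deriv_right_le_segment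
    ((hT.strongly_continuous f).mono Icc_subset_Ici_self) hderiv (C := M * ‖A f‖)
    (fun s hs => by
      refine ((T s).le_opNorm _).trans ?_
      rw [norm_neg]
      exact mul_le_mul_of_nonneg_right (hM ⟨s, Ico_subset_Icc_self hs⟩) (norm_nonneg _)) t ht
  simpa [hT.zero] using h

/-- A non-negative non-zero compact operator has its norm as an eigenvalue: otherwise the norm
would lie in the resolvent set, by the Fredholm alternative, and the Rayleigh quotient would stay
away from it. -/
theorem exists_apply_eq_norm_smul_of_isCompactOperator {R : E →L[𝕜] E}
    (hR : IsCompactOperator R) (hsymm : (R : E →ₗ[𝕜] E).IsSymmetric)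
    (hpos : ∀ g, 0 ≤ RCLike.re ⟪R g, g⟫_𝕜) (h0 : R ≠ 0) :
    ∃ g : E, g ≠ 0 ∧ R g = ((‖R‖ : ℝ) : 𝕜) • g := by
  have hn : (algebraMap ℝ 𝕜 ‖R‖) ≠ 0 := by simpa using h0
  obtain ⟨x, hx⟩ : ∃ x, R x ≠ 0 := by
    by_contra! h
    exact h0 (ContinuousLinearMap.ext h)
  have : Nontrivial E := ⟨⟨R x, 0, hx⟩⟩
  rcases hR.hasEigenvalue_or_mem_resolventSet hn with h | h
  · obtain ⟨g, hg⟩ := h.exists_hasEigenvector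
    exact ⟨g, hg.2, hg.apply_eq_smul⟩
  · exfalso
    obtain ⟨ε, hε, hle⟩ := R.rayleighQuotient_le_of_norm_mem_resolventSet h
    have habs : ∀ x, |R.rayleighQuotient x| ≤ ‖R‖ - ε := fun x => by
      rw [abs_of_nonneg]
      · exact hle x
      · exact div_nonneg (hpos x) (by positivity)
    have := ciSup_le habs
    rw [← R.norm_eq_iSup_rayleighQuotient hsymm] at this
    linarith

/-- If the semigroup of `-A` consists of compact operators, then a coercive bounded symmetric
perturbation `A + B` has a lowest eigenvalue, and it is the minimum of the quadratic form.

The inverse `R` of `A + B` is compact, being the norm limit of `T t ∘ R` as `t → 0+`, and the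
lowest eigenvalue of `A + B` is the reciprocal of the top eigenvalue `‖R‖` of `R`. -/
theorem IsSelfAdjoint.exists_lowest_eigenvalue_of_coercive [Nontrivial E]
    {A : E →ₗ.[𝕜] E} (hA : IsSelfAdjoint A) {T : ℝ → E →L[𝕜] E} (hT : IsSemigroupExpNeg A T)
    (hcomp : ∀ t, 0 < t → IsCompactOperator (T t))
    {B : E →L[𝕜] E} (hB : (B : E →ₗ[𝕜] E).IsSymmetric)
    (hcoer : ∀ f : A.domain, ‖(f : E)‖ ^ 2 ≤ RCLike.re ⟪A f + B f, (f : E)⟫_𝕜) :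
    ∃ m : ℝ, (∃ f : A.domain, f ≠ 0 ∧ A f + B f = (m : 𝕜) • (f : E)) ∧
      ∀ f : A.domain, m * ‖(f : E)‖ ^ 2 ≤ RCLike.re ⟪A f + B f, (f : E)⟫_𝕜 := by
  let L : A.domain →ₗ[𝕜] E := A.toFun + (B : E →ₗ[𝕜] E).comp A.domain.subtype
  have hL : ∀ f, L f = A f + B f := fun f => rfl
  have hLsymm : ∀ x y : A.domain, ⟪L x, (y : E)⟫_𝕜 = ⟪(x : E), L y⟫_𝕜 := fun x y => by
    have h' : ⟪B x, (y : E)⟫_𝕜 = ⟪(x : E), B y⟫_𝕜 := hB x y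
    rw [hL, hL, inner_add_left, inner_add_right, hA.inner_apply_left, h']
  have hlow : ∀ f : A.domain, ‖(f : E)‖ ≤ ‖L f‖ := fun f => by
    rcases (norm_nonneg (f : E)).eq_or_lt with h | h
    · rw [← h]; exact norm_nonneg _
    · have h1 := (hcoer f).trans (re_inner_le_norm (𝕜 := 𝕜) (A f + B f) (f : E))
      rw [sq] at h1
      exact le_of_mul_le_mul_right h1 h
  have hinj : Function.Injective L := by
    refine (injective_iff_map_eq_zero L).mpr fun f hf => ?_
    have := hlow f
    rw [hf, norm_zero] at this
    exact Subtype.ext (norm_le_zero_iff.mp this)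
  have hsurj : Function.Surjective L := hA.surjective_add_of_norm_le hB hlow
  let e : A.domain ≃ₗ[𝕜] E := LinearEquiv.ofBijective L ⟨hinj, hsurj⟩
  have he : ∀ g, L (e.symm g) = g := fun g => e.apply_symm_apply g
  let R : E →L[𝕜] E := (A.domain.subtype.comp (e.symm : E →ₗ[𝕜] A.domain)).mkContinuous 1
    fun g => by
      have := hlow (e.symm g)
      rw [he] at this
      simpa using this
  have hR : ∀ g, R g = (e.symm g : E) := fun g => rfl
  have hRsymm : (R : E →ₗ[𝕜] E).IsSymmetric := fun x y => by
    have := hLsymm (e.symm x) (e.symm y)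
    rw [he, he] at this
    exact this.symm
  have hRpos : ∀ g, 0 ≤ RCLike.re ⟪R g, g⟫_𝕜 := fun g => by
    have h := (sq_nonneg _).trans (hcoer (e.symm g))
    rwa [← hL, he, inner_re_symm] at h
  have hR0 : R ≠ 0 := fun h => by
    obtain ⟨x, hx⟩ := exists_ne (0 : E)
    have h1 : e.symm x = 0 := Subtype.ext (by rw [← hR, h]; rfl)
    exact hx (by rw [← he x, h1, map_zero])
  have hRcomp : IsCompactOperator R := by
    obtain ⟨M, hM0, hM⟩ := hT.exists_norm_sub_le
    have hlim : Tendsto (fun t : ℝ => (T t).comp R) (𝓝[>] 0) (𝓝 R) := by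
      rw [tendsto_iff_norm_sub_tendsto_zero]
      have hz : Tendsto (fun t : ℝ => M * (1 + ‖B.comp R‖) * t) (𝓝[>] 0) (𝓝 0) := by
        have : Tendsto (fun t : ℝ => M * (1 + ‖B.comp R‖) * t) (𝓝 0) (𝓝 _) :=
          (tendsto_id (α := ℝ)).const_mul _
        rw [mul_zero] at this
        exact this.mono_left nhdsWithin_le_nhds
      refine squeeze_zero' (.of_forall fun _ => norm_nonneg _) ?_ hz
      filter_upwards [Ioc_mem_nhdsGT (zero_lt_one (α := ℝ))] with t ht
      refine ContinuousLinearMap.opNorm_le_bound _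
        (mul_nonneg (mul_nonneg hM0 (by positivity)) ht.1.le) fun g => ?_
      -- `A R` is bounded, since `A R = 1 - B R`.
      have hAg : A (e.symm g) = g - B.comp R g := by
        rw [eq_sub_iff_add_eq]
        exact he g
      have hAn : ‖A (e.symm g)‖ ≤ (1 + ‖B.comp R‖) * ‖g‖ := by
        rw [hAg, add_mul, one_mul]
        exact (norm_sub_le _ _).trans (add_le_add le_rfl ((B.comp R).le_opNorm g))
      calc ‖((T t).comp R - R) g‖ = ‖T t (e.symm g : E) - e.symm g‖ := rfl
        _ ≤ M * ‖A (e.symm g)‖ * t := hM t ⟨ht.1.le, ht.2⟩ _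
        _ ≤ M * ((1 + ‖B.comp R‖) * ‖g‖) * t :=
          mul_le_mul_of_nonneg_right (mul_le_mul_of_nonneg_left hAn hM0) ht.1.le
        _ = M * (1 + ‖B.comp R‖) * t * ‖g‖ := by ring
    refine isCompactOperator_of_tendsto hlim ?_
    filter_upwards [self_mem_nhdsWithin] with t ht
    exact (hcomp t ht).comp_clm R
  have hρ : 0 < ‖R‖ := norm_pos_iff.mpr hR0
  obtain ⟨g, hg0, hg⟩ := exists_apply_eq_norm_smul_of_isCompactOperator hRcomp hRsymm hRpos hR0
  have hρ𝕜 : ((‖R‖ : ℝ) : 𝕜) ≠ 0 := by exact_mod_cast hρ.ne'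
  refine ⟨‖R‖⁻¹, ⟨e.symm g, ?_, ?_⟩, fun f => ?_⟩
  · simpa using hg0
  · rw [← hL, he, ← hR, hg, smul_smul, RCLike.ofReal_inv, inv_mul_cancel₀ hρ𝕜, one_smul]
  · -- Cauchy–Schwarz for the form of `A + B`, tested against `R f`.
    have hcs := norm_inner_sq_le_of_nonneg L hLsymm
      (fun x => (sq_nonneg _).trans (hcoer x)) f (e.symm (f : E))
    rw [hLsymm, he, inner_self_eq_norm_sq_to_K] at hcs
    have h2 : RCLike.re ⟪(f : E), (e.symm (f : E) : E)⟫_𝕜 ≤ ‖R‖ * ‖(f : E)‖ ^ 2 := by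
      refine (re_inner_le_norm _ _).trans ?_
      rw [← hR]
      nlinarith [R.le_opNorm (f : E), norm_nonneg (f : E)]
    have hq : 0 ≤ RCLike.re ⟪L f, (f : E)⟫_𝕜 := (sq_nonneg _).trans (hcoer f)
    rw [← hL]
    rw [norm_pow, RCLike.norm_ofReal, abs_norm] at hcs
    rcases (norm_nonneg (f : E)).eq_or_lt with h | h
    · rw [← h]; simpa using hq
    · have h3 := hcs.trans (mul_le_mul_of_nonneg_left h2 hq)
      rw [inv_mul_le_iff₀ hρ]
      have : 0 < ‖(f : E)‖ ^ 2 := by positivity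
      refine le_of_mul_le_mul_right ?_ this
      nlinarith

end Hilbert

/-! ### Integral operators with a continuous kernel -/

section Kernel

variable {X 𝕜 : Type*} [RCLike 𝕜] [MetricSpace X] [CompactSpace X] [MeasurableSpace X]
  [BorelSpace X] {μ : Measure X} [IsFiniteMeasure μ]

/-- For a continuous family `φ` of vectors, the functions `x ↦ ⟪φ x, f⟫` with `‖f‖ ≤ 1` form a
relatively compact set, by the Arzelà–Ascoli theorem. -/
theorem isCompact_closure_inner_family {X 𝕜 E : Type*} [RCLike 𝕜] [TopologicalSpace X]
    [CompactSpace X] [NormedAddCommGroup E] [InnerProductSpace 𝕜 E] (φ : C(X, E)) :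
    IsCompact (closure {u : BoundedContinuousFunction X 𝕜 |
      ∃ f ∈ Metric.closedBall (0 : E) 1, ∀ x, u x = ⟪φ x, f⟫_𝕜}) := by
  have hf1 : ∀ f ∈ Metric.closedBall (0 : E) 1, ‖f‖ ≤ 1 := fun f hf => by simpa using hf
  refine BoundedContinuousFunction.arzela_ascoli (Metric.closedBall (0 : 𝕜) ‖φ‖)
    (isCompact_closedBall _ _) _ ?_ ?_
  · rintro u x ⟨f, hf, hu⟩
    rw [mem_closedBall_zero_iff, hu]
    calc ‖⟪φ x, f⟫_𝕜‖ ≤ ‖φ x‖ * ‖f‖ := norm_inner_le_norm _ _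
      _ ≤ ‖φ‖ * 1 := mul_le_mul (φ.norm_coe_le_norm x) (hf1 f hf) (norm_nonneg _) (norm_nonneg _)
      _ = ‖φ‖ := mul_one _
  · intro x₀
    refine Metric.equicontinuousAt_of_continuity_modulus (fun x => ‖φ x₀ - φ x‖) ?_ _ ?_
    · have : Tendsto (fun x => ‖φ x₀ - φ x‖) (𝓝 x₀) (𝓝 ‖φ x₀ - φ x₀‖) :=
        (tendsto_const_nhds.sub (φ.continuous.tendsto x₀)).norm
      simpa using this
    · refine .of_forall fun x => ?_
      rintro ⟨u, f, hf, hu⟩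
      change dist (u x₀) (u x) ≤ _
      rw [hu, hu, dist_eq_norm, ← inner_sub_left]
      calc ‖⟪φ x₀ - φ x, f⟫_𝕜‖ ≤ ‖φ x₀ - φ x‖ * ‖f‖ := norm_inner_le_norm _ _
        _ ≤ ‖φ x₀ - φ x‖ * 1 := mul_le_mul_of_nonneg_left (hf1 f hf) (norm_nonneg _)
        _ = _ := mul_one _

/-- An integral operator on `L²` of a compact space of finite measure, with a continuous real
kernel, is compact. -/
theorem isCompactOperator_of_continuous_kernel {k : X → X → ℝ}
    (hk : Continuous fun p : X × X => k p.1 p.2) {S : Lp 𝕜 2 μ →L[𝕜] Lp 𝕜 2 μ}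
    (hS : ∀ f : Lp 𝕜 2 μ, S f =ᵐ[μ] fun x => ∫ y, (k x y : 𝕜) * f y ∂μ) :
    IsCompactOperator S := by
  let k' : C(X × X, 𝕜) := ⟨fun p => (k p.1 p.2 : 𝕜), RCLike.continuous_ofReal.comp hk⟩
  let φ : C(X, Lp 𝕜 2 μ) :=
    ⟨fun x => ContinuousMap.toLp 2 μ 𝕜 (k'.curry x),
      (ContinuousMap.toLp (E := 𝕜) 2 μ 𝕜).continuous.comp k'.curry.continuous⟩
  have hφ : ∀ x (f : Lp 𝕜 2 μ), ⟪φ x, f⟫_𝕜 = ∫ y, (k x y : 𝕜) * f y ∂μ := fun x f => by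
    rw [L2.inner_def]
    refine integral_congr_ae ?_
    filter_upwards [ContinuousMap.coeFn_toLp (E := 𝕜) (p := 2) (𝕜 := 𝕜) μ (k'.curry x)] with y hy
    change ⟪(ContinuousMap.toLp 2 μ 𝕜 (k'.curry x) : Lp 𝕜 2 μ) y, f y⟫_𝕜 = _
    rw [hy, RCLike.inner_apply, mul_comm]
    simp [k']
  refine (isCompactOperator_iff_image_closedBall_subset_compact (S : Lp 𝕜 2 μ →ₗ[𝕜] Lp 𝕜 2 μ)
    one_pos).mpr ⟨_, (isCompact_closure_inner_family (𝕜 := 𝕜) φ).image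
      (BoundedContinuousFunction.toLp (E := 𝕜) 2 μ 𝕜).continuous, ?_⟩
  rintro _ ⟨f, hf, rfl⟩
  let u : BoundedContinuousFunction X 𝕜 := BoundedContinuousFunction.mkOfCompact
    ⟨fun x => ⟪φ x, f⟫_𝕜, φ.continuous.inner continuous_const⟩
  refine ⟨u, subset_closure ⟨f, hf, fun _ => rfl⟩, Lp.ext ?_⟩
  filter_upwards [BoundedContinuousFunction.coeFn_toLp (E := 𝕜) (p := 2) (𝕜 := 𝕜) μ u, hS f]
    with x h1 h2
  rw [h1]
  exact (hφ x f).trans h2.symm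

theorem IsContinuousKernel.isCompactOperator {T : ℝ → Lp 𝕜 2 μ →L[𝕜] Lp 𝕜 2 μ}
    {K : ℝ → X → X → ℝ} (h : IsContinuousKernel μ T K) {t : ℝ} (ht : 0 < t) :
    IsCompactOperator (T t) := by
  refine isCompactOperator_of_continuous_kernel (k := K t) ?_ (h.integral_eq t ht)
  exact h.continuousOn.comp_continuous (f := fun p : X × X => (t, p.1, p.2)) (by fun_prop)
    fun p => ⟨ht, mem_univ _⟩

end Kernel

/-! ### Multiplication by a bounded potential -/

section Potential

variable {X 𝕜 : Type*} [RCLike 𝕜] [MeasurableSpace X] {μ : Measure X}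

theorem mulPotential_isSymmetric (V : Lp ℝ ∞ μ) : (mulPotential 𝕜 μ V).IsSymmetric := fun f g => by
  change ⟪(V • f : Lp 𝕜 2 μ), g⟫_𝕜 = ⟪f, (V • g : Lp 𝕜 2 μ)⟫_𝕜
  rw [L2.inner_def, L2.inner_def]
  refine integral_congr_ae ?_
  filter_upwards [Lp.coeFn_lpSMul (r := 2) V f, Lp.coeFn_lpSMul (r := 2) V g] with x h1 h2
  rw [h1, h2, Pi.smul_apply', Pi.smul_apply', RCLike.real_smul_eq_coe_smul (K := 𝕜),
    RCLike.real_smul_eq_coe_smul (K := 𝕜), inner_smul_left, inner_smul_right, RCLike.conj_ofReal]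

/-- On constants, the form of the multiplication operator is a multiple of the mean of `V`. -/
theorem inner_mulPotential_const [IsFiniteMeasure μ] (V : Lp ℝ ∞ μ) (a : ℝ) :
    ⟪mulPotential 𝕜 μ V (Lp.const 2 μ (a : 𝕜)), Lp.const 2 μ (a : 𝕜)⟫_𝕜
      = ((a ^ 2 * ∫ x, V x ∂μ : ℝ) : 𝕜) := by
  change ⟪(V • Lp.const 2 μ (a : 𝕜) : Lp 𝕜 2 μ), _⟫_𝕜 = _
  rw [L2.inner_def, ← integral_const_mul, ← integral_ofReal]
  refine integral_congr_ae ?_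
  filter_upwards [Lp.coeFn_lpSMul (r := 2) V (Lp.const 2 μ (a : 𝕜)),
    Lp.coeFn_const (p := 2) (μ := μ) (a : 𝕜)] with x h1 h2
  rw [h1, Pi.smul_apply', h2, Function.const_apply, RCLike.real_smul_eq_coe_smul (K := 𝕜),
    RCLike.inner_apply]
  simp
  ring

/-- A potential that annihilates a non-zero constant vanishes. -/
theorem eq_zero_of_mulPotential_const_eq_zero [IsFiniteMeasure μ] {V : Lp ℝ ∞ μ} {a : 𝕜}
    (ha : a ≠ 0) (h : mulPotential 𝕜 μ V (Lp.const 2 μ a) = 0) : V = 0 := by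
  have h' : (V • Lp.const 2 μ a : Lp 𝕜 2 μ) = 0 := h
  refine Lp.ext ?_
  have h0 := Lp.coeFn_lpSMul (r := 2) V (Lp.const 2 μ a)
  rw [h'] at h0
  filter_upwards [h0, Lp.coeFn_const (p := 2) (μ := μ) a, Lp.coeFn_zero 𝕜 2 μ,
    Lp.coeFn_zero ℝ ∞ μ] with x h1 h2 h3 h4
  rw [h3, Pi.smul_apply', h2, Function.const_apply, Pi.zero_apply, eq_comm, smul_eq_zero] at h1
  rw [h4]
  exact h1.resolve_right ha

end Potential

/-! ### Eigenvalues and the quadratic form -/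

section Eigenvalues

variable {𝕜 E : Type*} [RCLike 𝕜] [NormedAddCommGroup E] [InnerProductSpace 𝕜 E]

theorem mem_eigenspaceOf_iff {A : E →ₗ.[𝕜] E} {z : 𝕜} {x : E} :
    x ∈ eigenspaceOf A z ↔ ∃ f : A.domain, (f : E) = x ∧ A f = z • x := by
  constructor
  · rintro ⟨f, hf, rfl⟩
    exact ⟨f, rfl, sub_eq_zero.mp hf⟩
  · rintro ⟨f, rfl, hf⟩
    exact ⟨f, sub_eq_zero.mpr hf, rfl⟩

theorem mem_realEigenvalues_iff {A : E →ₗ.[𝕜] E} {l : ℝ} :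
    l ∈ realEigenvalues A ↔ ∃ f : A.domain, f ≠ 0 ∧ A f = (l : 𝕜) • (f : E) := by
  refine (Submodule.ne_bot_iff _).trans ⟨?_, ?_⟩
  · rintro ⟨x, hx, hx0⟩
    obtain ⟨f, rfl, hf⟩ := mem_eigenspaceOf_iff.mp hx
    exact ⟨f, fun h => hx0 (by rw [h]; rfl), hf⟩
  · rintro ⟨f, hf0, hf⟩
    exact ⟨f, mem_eigenspaceOf_iff.mpr ⟨f, rfl, hf⟩, fun h => hf0 (Subtype.ext h)⟩

/-- An eigenvalue that bounds the quadratic form from below is the smallest eigenvalue. -/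
theorem isLeast_realEigenvalues {A : E →ₗ.[𝕜] E} {m : ℝ}
    (hm : ∃ f : A.domain, f ≠ 0 ∧ A f = (m : 𝕜) • (f : E))
    (hle : ∀ f : A.domain, m * ‖(f : E)‖ ^ 2 ≤ RCLike.re ⟪A f, (f : E)⟫_𝕜) :
    IsLeast (realEigenvalues A) m := by
  refine ⟨mem_realEigenvalues_iff.mpr hm, fun l hl => ?_⟩
  obtain ⟨f, hf0, hf⟩ := mem_realEigenvalues_iff.mp hl
  have h := hle f
  rw [hf, inner_smul_left, RCLike.conj_ofReal, inner_self_eq_norm_sq_to_K, RCLike.re_ofReal_mul,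
    ← RCLike.ofReal_pow, RCLike.ofReal_re] at h
  have hf' : (f : E) ≠ 0 := fun h => hf0 (Subtype.ext h)
  exact le_of_mul_le_mul_right h (by positivity)

end Eigenvalues

/-! ### Perturbation by a potential -/

section Schrodinger

variable {X 𝕜 : Type*} [RCLike 𝕜] [MeasurableSpace X] {μ : Measure X}

theorem addPotential_apply (H₀ : Lp 𝕜 2 μ →ₗ.[𝕜] Lp 𝕜 2 μ) (V : Lp ℝ ∞ μ) (f : H₀.domain) :
    addPotential H₀ V f = H₀ f + mulPotential 𝕜 μ V f := rfl

/-- If the semigroup of `-H₀` consists of compact operators, then `H₀ + V` has a lowest eigenvalue,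
and it is the minimum of the quadratic form. -/
theorem exists_lowest_eigenvalue_addPotential [Nontrivial (Lp 𝕜 2 μ)]
    {H₀ : Lp 𝕜 2 μ →ₗ.[𝕜] Lp 𝕜 2 μ} (hsa : IsSelfAdjoint H₀) (hnonneg : IsNonnegOperator H₀)
    {T : ℝ → Lp 𝕜 2 μ →L[𝕜] Lp 𝕜 2 μ} (hT : IsSemigroupExpNeg H₀ T)
    (hcomp : ∀ t, 0 < t → IsCompactOperator (T t)) (V : Lp ℝ ∞ μ) :
    ∃ m : ℝ, (∃ f : H₀.domain, f ≠ 0 ∧ addPotential H₀ V f = (m : 𝕜) • (f : Lp 𝕜 2 μ)) ∧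
      ∀ f : H₀.domain, m * ‖(f : Lp 𝕜 2 μ)‖ ^ 2 ≤
        RCLike.re ⟪addPotential H₀ V f, (f : Lp 𝕜 2 μ)⟫_𝕜 := by
  let W : Lp 𝕜 2 μ →L[𝕜] Lp 𝕜 2 μ :=
    (mulPotential 𝕜 μ V).mkContinuous ‖V‖ fun f => Lp.norm_smul_le V f
  have hW : ∀ f, W f = mulPotential 𝕜 μ V f := fun _ => rfl
  -- The shift by `‖V‖ + 1` makes the form of `H₀ + V` coercive.
  set c : ℝ := ‖V‖ + 1 with hc
  let B : Lp 𝕜 2 μ →L[𝕜] Lp 𝕜 2 μ := W + (c : 𝕜) • ContinuousLinearMap.id 𝕜 _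
  have hB : ∀ f, B f = mulPotential 𝕜 μ V f + (c : 𝕜) • f := fun _ => rfl
  have hBsymm : (B : Lp 𝕜 2 μ →ₗ[𝕜] Lp 𝕜 2 μ).IsSymmetric := fun f g => by
    change ⟪B f, g⟫_𝕜 = ⟪f, B g⟫_𝕜
    rw [hB, hB, inner_add_left, inner_add_right, mulPotential_isSymmetric, inner_smul_left,
      inner_smul_right, RCLike.conj_ofReal]
  have hself : ∀ f : Lp 𝕜 2 μ, RCLike.re ⟪(c : 𝕜) • f, f⟫_𝕜 = c * ‖f‖ ^ 2 := fun f => by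
    rw [inner_smul_left, RCLike.conj_ofReal, inner_self_eq_norm_sq_to_K, RCLike.re_ofReal_mul,
      ← RCLike.ofReal_pow, RCLike.ofReal_re]
  have hsplit : ∀ f : H₀.domain, H₀ f + B f = addPotential H₀ V f + (c : 𝕜) • (f : Lp 𝕜 2 μ) :=
    fun f => by rw [hB, addPotential_apply, add_assoc]
  have hcoer : ∀ f : H₀.domain,
      ‖(f : Lp 𝕜 2 μ)‖ ^ 2 ≤ RCLike.re ⟪H₀ f + B f, (f : Lp 𝕜 2 μ)⟫_𝕜 := fun f => by
    have h1 := hnonneg f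
    have h2 : -(‖V‖ * ‖(f : Lp 𝕜 2 μ)‖ ^ 2) ≤
        RCLike.re ⟪mulPotential 𝕜 μ V f, (f : Lp 𝕜 2 μ)⟫_𝕜 := by
      have hn : ‖⟪mulPotential 𝕜 μ V f, (f : Lp 𝕜 2 μ)⟫_𝕜‖ ≤ ‖V‖ * ‖(f : Lp 𝕜 2 μ)‖ ^ 2 := by
        calc _ ≤ ‖mulPotential 𝕜 μ V f‖ * ‖(f : Lp 𝕜 2 μ)‖ := norm_inner_le_norm _ _
          _ ≤ ‖V‖ * ‖(f : Lp 𝕜 2 μ)‖ * ‖(f : Lp 𝕜 2 μ)‖ :=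
            mul_le_mul_of_nonneg_right (Lp.norm_smul_le V (f : Lp 𝕜 2 μ)) (norm_nonneg _)
          _ = _ := by ring
      exact (abs_le.mp ((RCLike.abs_re_le_norm _).trans hn)).1
    rw [hB, inner_add_left, inner_add_left, map_add, map_add, hself, hc]
    linarith
  obtain ⟨m, ⟨f, hf0, hf⟩, hm⟩ :=
    hsa.exists_lowest_eigenvalue_of_coercive hT hcomp hBsymm hcoer
  refine ⟨m - c, ⟨f, hf0, ?_⟩, fun g => ?_⟩
  · rw [hsplit] at hf
    rw [eq_sub_of_add_eq hf, ← sub_smul, RCLike.ofReal_sub]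
  · have h := hm g
    rw [hsplit, inner_add_left, map_add, hself] at h
    linarith

/-- If the form of `H₀ + V` is non-negative, and a non-zero constant is in the kernel of `H₀`, then
a potential of non-positive mean vanishes: the constant minimises the form, hence is in the kernel
of `H₀ + V` as well. -/
theorem eq_zero_of_form_nonneg [IsFiniteMeasure μ]
    {H₀ : Lp 𝕜 2 μ →ₗ.[𝕜] Lp 𝕜 2 μ} (hsa : IsSelfAdjoint H₀) {V : Lp ℝ ∞ μ} {a : ℝ} (ha : a ≠ 0)
    (hconst : ∃ u : H₀.domain, (u : Lp 𝕜 2 μ) = Lp.const 2 μ (a : 𝕜) ∧ H₀ u = 0)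
    (hform : ∀ f : H₀.domain, 0 ≤ RCLike.re ⟪addPotential H₀ V f, (f : Lp 𝕜 2 μ)⟫_𝕜)
    (hV : ∫ x, V x ∂μ ≤ 0) : V = 0 := by
  obtain ⟨u, hu, hu0⟩ := hconst
  have hHu : addPotential H₀ V u = mulPotential 𝕜 μ V (Lp.const 2 μ (a : 𝕜)) := by
    rw [addPotential_apply, hu0, zero_add, hu]
  have hqu : RCLike.re ⟪addPotential H₀ V u, (u : Lp 𝕜 2 μ)⟫_𝕜 = 0 := by
    refine le_antisymm ?_ (hform u)
    rw [hHu, hu, inner_mulPotential_const, RCLike.ofReal_re]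
    exact mul_nonpos_of_nonneg_of_nonpos (sq_nonneg a) hV
  have hzero : addPotential H₀ V u = 0 := by
    refine hsa.dense_domain.eq_zero_of_inner_left 𝕜 fun f hf => ?_
    have h := norm_inner_sq_le_of_nonneg (addPotential H₀ V).toFun
      (fun f g : H₀.domain => by
        change ⟪addPotential H₀ V f, (g : Lp 𝕜 2 μ)⟫_𝕜 = ⟪(f : Lp 𝕜 2 μ), addPotential H₀ V g⟫_𝕜
        rw [addPotential_apply, addPotential_apply, inner_add_left, inner_add_right,
          mulPotential_isSymmetric, hsa.inner_apply_left])
      hform u ⟨f, hf⟩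
    have hle : ‖⟪addPotential H₀ V u, f⟫_𝕜‖ ^ 2 ≤ 0 := h.trans_eq (mul_eq_zero_of_left hqu _)
    exact norm_eq_zero.mp (pow_eq_zero_iff two_ne_zero |>.mp (le_antisymm hle (sq_nonneg _)))
  exact eq_zero_of_mulPotential_const_eq_zero (RCLike.ofReal_ne_zero.mpr ha) (hHu.symm.trans hzero)

end Schrodinger

theorem mainTheorem3 {X 𝕜 : Type*} [RCLike 𝕜]
    [MetricSpace X] [CompactSpace X] [MeasurableSpace X] [BorelSpace X]
    (μ : Measure X) [IsFiniteMeasure μ]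
    (H₀ : Lp 𝕜 2 μ →ₗ.[𝕜] Lp 𝕜 2 μ)
    (hsa : IsSelfAdjoint H₀) (hnonneg : IsNonnegOperator H₀) (hdisc : HasDiscreteSpectrum H₀)
    (T : ℝ → Lp 𝕜 2 μ →L[𝕜] Lp 𝕜 2 μ) (hT : IsSemigroupExpNeg H₀ T)
    (K₀ : ℝ → X → X → ℝ) (d : ℝ) (hd : 0 < d)
    (h1 : IsContinuousKernel μ T K₀)
    (h2 : HasDiagonalBound K₀ d)
    (h3 : HasDiagonalLimit μ K₀ d)
    (h4 : HasConstantGroundState H₀)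
    (V : Lp ℝ ∞ μ) :
    (∃ μ₁ : ℝ, IsLeast (realEigenvalues (addPotential H₀ V)) μ₁) ∧
      ∀ μ₁ : ℝ, IsLeast (realEigenvalues (addPotential H₀ V)) μ₁ →
        0 ≤ μ₁ → ∫ x, V x ∂μ ≤ 0 → V = 0 := by
  obtain ⟨f₀, hf₀, -⟩ := mem_realEigenvalues_iff.mp h4.isLeast.1
  have : Nontrivial (Lp 𝕜 2 μ) := ⟨⟨f₀, 0, fun h => hf₀ (Subtype.ext h)⟩⟩
  obtain ⟨m, hm, hle⟩ := exists_lowest_eigenvalue_addPotential hsa hnonneg hT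
    (fun t ht => h1.isCompactOperator ht) V
  have hleast : IsLeast (realEigenvalues (addPotential H₀ V)) m := isLeast_realEigenvalues hm hle
  refine ⟨⟨m, hleast⟩, fun μ₁ hμ₁ hμ₁0 hV => ?_⟩
  obtain rfl := hμ₁.unique hleast
  -- The measure is not zero, since `L²` has a non-zero element.
  have hμ : 0 < μ.real univ := by
    refine measureReal_nonneg.lt_of_ne' fun h => hf₀ (Subtype.ext (Lp.ext ?_))
    have hμ0 : μ = 0 := Measure.measure_univ_eq_zero.mp
      ((measureReal_eq_zero_iff (measure_ne_top μ univ)).mp h)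
    have hfalse : ∀ᵐ _ ∂μ, False := by
      rw [hμ0, ae_zero]
      exact eventually_bot
    exact hfalse.mono fun _ => False.elim
  obtain ⟨u, hu, hu0⟩ := mem_eigenspaceOf_iff.mp h4.eigenfunction
  rw [zero_smul] at hu0
  exact eq_zero_of_form_nonneg hsa (Real.rpow_pos_of_pos hμ _).ne' ⟨u, hu, hu0⟩
    (fun f => (mul_nonneg hμ₁0 (sq_nonneg _)).trans (hle f)) hV
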